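/- For $r\ge 2$ let $\mathcal A_r$ be the real Cayley-Dickson algebra with standard generators $i_0=1,i_1,\dots,i_{2^r-1}$ (obtained from $\mathbb R$ by $r$ doublings, $i_j i_{2^m}=i_{2^m+j}$ for $0\le j<2^m$), with the Euclidean norm $|z|^2=z\tilde z$; thus $\mathcal A_2=\mathbb H$, $\mathcal A_3=\mathbb O$. Put $\exp(z)=\sum_n z^n/n!$ and $\mathrm{Re}(z)=z_0$ for $z=\sum_j z_j i_j$. A function $f:\mathbb R\to\mathcal A_r$ is an original with growth exponent $s_0\in\mathbb R$ if: at every point $t$ of continuity of $f$ there are $\alpha\in(0,1]$, $A>0$, $\delta>0$ (depending on $t$) with $|f(t+h)-f(t)|\le A|h|^\alpha$ for all $|h|<\delta$; at every point of discontinuity $f$ has finite left and right limits, and each finite interval contains only finitely many such points; $f(t)=0$ for $t<0$; and $|f(t)|<C e^{s_0t}$ for all $t\in\mathbb R$ with some constant $C>0$. Let $N_j=v(i_j)$ for an automorphism $v$ of the real algebra $\mathcal A_r$. Let $u$ be one of the two functions $$u(p,t;\zeta)=pt+\zeta\qquad\text{or}\qquad u(p,t;\zeta)=p_0t+M_N(p,t;\zeta)+\zeta_0,$$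 where, with $p=\sum_j p_jN_j$, $\zeta=\sum_j\zeta_jN_j$ ($p_j,\zeta_j\in\mathbb R$), $\theta_j=p_jt+\zeta_j$ and $n=2^r-1$, $$M_N(p,t;\zeta)=\theta_1\,\bigl[N_1\cos\theta_2+N_2\sin\theta_2\cos\theta_3+\dots+N_{n-1}\sin\theta_2\cdots\sin\theta_{n-1}\cos\theta_n+N_n\sin\theta_2\cdots\sin\theta_n\bigr].$$ The image of an original $f$ is $$F_u(p;\zeta)=\int_0^\infty f(t)\exp(-u(p,t;\zeta))\,dt ,$$ and the image written by components is ${}_NF_u(p;\zeta)=\sum_{s=0}^{2^r-1}F_{u,s}(p;\zeta)N_s$, where $f=\sum_s f_sN_s$ with real-valued $f_s$ and $F_{u,s}$ is the image of $f_s$. **Theorem.** Let $f,g:\mathbb R\to\mathcal A_r$ be originals with growth exponents $s_f$ and $s_g$, where either $r\in\{2,3\}$, or $r\ge4$ and $f,g$ are real-valued. Let $\zeta\in\mathcal A_r$. Then the images of $f$ and $g$ coincide, that is, $F_u(p;\zeta)=G_u(p;\zeta)$ for all $p\in\mathcal A_r$ with $\mathrm{Re}(p)>\max(s_f,s_g)$,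 if and only if $f(t)=g(t)$ at every $t\in\mathbb R$ at which both $f$ and $g$ are continuous. The same equivalence holds for the images ${}_NF_u$ and ${}_NG_u$ written by components. In other words, an original is determined by its image up to its values at points of discontinuity. -/

import Mathlib

open Filter MeasureTheory
open scoped Topology

noncomputable section

namespace CayleyDickson

/-- The underlying real Euclidean space of the Cayley-Dickson algebra of dimension `2 ^ r`;
the coordinate with index `j` is the coefficient of the standard generator `i_j`. -/
abbrev CD (r : ℕ) : Type := EuclideanSpace ℝ (Fin (2 ^ r))

/-- The `j`-th real coordinate of `x` (and `0` if `j` is out of range). -/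
def coord {r : ℕ} (x : CD r) (j : ℕ) : ℝ := if h : j < 2 ^ r then x ⟨j, h⟩ else 0

/-- The element with prescribed coordinates. -/
def ofCoord (r : ℕ) (c : ℕ → ℝ) : CD r := WithLp.toLp 2 fun j => c j

/-- The standard generator `i_j`. -/
def gen (r : ℕ) (j : ℕ) : CD r := ofCoord r fun k => if k = j then 1 else 0

/-- The unit `i_0 = 1`. -/
def one (r : ℕ) : CD r := gen r 0

/-- The real part. -/
def re {r : ℕ} (x : CD r) : ℝ := coord x 0

/-- The conjugation, which changes the sign of all coordinates except the real one. -/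
def conj {r : ℕ} (x : CD r) : CD r :=
  ofCoord r fun j => if j = 0 then coord x 0 else - coord x j

/-- In the decomposition `x = a + b l`, where `l = i_{2^r}` is the doubling generator and
`i_j l = i_{2^r + j}`, the part `a`. -/
def lo {r : ℕ} (x : CD (r + 1)) : CD r := ofCoord r fun j => coord x j

/-- In the decomposition `x = a + b l`, the part `b`. -/
def hi {r : ℕ} (x : CD (r + 1)) : CD r := ofCoord r fun j => coord x (2 ^ r + j)

/-- The element `a + b l` of the doubled algebra. -/
def glue {r : ℕ} (a b : CD r) : CD (r + 1) :=
  ofCoord (r + 1) fun j => if j < 2 ^ r then coord a j else coord b (j - 2 ^ r)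

/-- The Cayley-Dickson product, by the doubling procedure
`(a + b l)(c + d l) = (a c - d* b) + (d a + b c*) l`, starting from the real numbers. -/
def mul : {r : ℕ} → CD r → CD r → CD r
  | 0, x, y => ofCoord 0 fun _ => coord x 0 * coord y 0
  | _ + 1, x, y =>
      glue (mul (lo x) (lo y) - mul (conj (hi y)) (hi x))
        (mul (hi y) (lo x) + mul (hi x) (conj (lo y)))

/-- Powers `z ^ n` (the algebra is power associative, so the bracketing is immaterial). -/
def npow {r : ℕ} (z : CD r) : ℕ → CD r
  | 0 => one r
  | n + 1 => mul z (npow z n)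

/-- The exponential function `∑ zⁿ / n!`. -/
def exp {r : ℕ} (z : CD r) : CD r := ∑' n : ℕ, ((n.factorial : ℝ)⁻¹) • npow z n

/-- An automorphism of the real algebra `CD r`. It sends the standard generators `i_j` to new
generators `N_j`. -/
structure Aut (r : ℕ) where
  toEquiv : CD r ≃ₗ[ℝ] CD r
  map_mul : ∀ x y : CD r, toEquiv (mul x y) = mul (toEquiv x) (toEquiv y)

/-- The generator `N_j`. -/
def Aut.gen {r : ℕ} (N : Aut r) (j : ℕ) : CD r := N.toEquiv (CayleyDickson.gen r j)

/-- The real coordinates of `x` in the basis `N_0, …, N_{2^r-1}`. -/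
def Aut.coord {r : ℕ} (N : Aut r) (x : CD r) (j : ℕ) : ℝ :=
  CayleyDickson.coord (N.toEquiv.symm x) j

/-- `f` is a function-original whose growth is bounded by the exponent `s₀`. -/
structure IsOriginal {r : ℕ} (f : ℝ → CD r) (s₀ : ℝ) : Prop where
  /-- the pointwise Hölder condition, outside the points of discontinuity -/
  hoelder : ∀ t : ℝ, ContinuousAt f t →
    ∃ α A δ : ℝ, 0 < α ∧ α ≤ 1 ∧ 0 < A ∧ 0 < δ ∧
      ∀ h : ℝ, |h| < δ → ‖f (t + h) - f t‖ ≤ A * |h| ^ α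
  /-- every discontinuity is of the first kind -/
  first_kind : ∀ t : ℝ, ¬ ContinuousAt f t →
    (∃ l : CD r, Tendsto f (𝓝[<] t) (𝓝 l)) ∧ ∃ l : CD r, Tendsto f (𝓝[>] t) (𝓝 l)
  /-- there are finitely many discontinuities on each finite interval -/
  finite_disc : ∀ a b : ℝ, {t : ℝ | t ∈ Set.Icc a b ∧ ¬ ContinuousAt f t}.Finite
  zero_of_neg : ∀ t : ℝ, t < 0 → f t = 0
  growth : ∃ C : ℝ, 0 < C ∧ ∀ t : ℝ, ‖f t‖ < C * Real.exp (s₀ * t)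

/-- The values that are allowed: arbitrary ones in the quaternions (`r = 2`) and in the octonions
(`r = 3`), real ones in the Cayley-Dickson algebras with `r ≥ 4`. -/
def AdmissibleValues {r : ℕ} (f : ℝ → CD r) : Prop :=
  r = 2 ∨ r = 3 ∨ (4 ≤ r ∧ ∀ t : ℝ, ∃ x : ℝ, f t = x • one r)

/-- The linear phase `u(p,t;ζ) = p t + ζ`. -/
def phaseLinear {r : ℕ} (p : CD r) (t : ℝ) (ζ : CD r) : CD r := t • p + ζ

/-- The angle `p_j t + ζ_j`, coordinates being taken in the basis `N`. -/
def angle {r : ℕ} (N : Aut r) (p : CD r) (t : ℝ) (ζ : CD r) (j : ℕ) : ℝ :=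
  N.coord p j * t + N.coord ζ j

/-- `M_N(p,t;ζ) = (p_1 t + ζ_1) [N_1 cos θ_2 + N_2 sin θ_2 cos θ_3 + …
+ N_{n-1} sin θ_2 ⋯ sin θ_{n-1} cos θ_n + N_n sin θ_2 ⋯ sin θ_n]`
with `θ_j = p_j t + ζ_j` and `n = 2 ^ r - 1`. -/
def sphericalM {r : ℕ} (N : Aut r) (p : CD r) (t : ℝ) (ζ : CD r) : CD r :=
  angle N p t ζ 1 • ∑ k ∈ Finset.Icc 1 (2 ^ r - 1),
    ((∏ j ∈ Finset.Icc 2 k, Real.sin (angle N p t ζ j)) *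
      (if k = 2 ^ r - 1 then 1 else Real.cos (angle N p t ζ (k + 1)))) • N.gen k

/-- The nonlinear phase `u(p,t;ζ) = p_0 t + M_N(p,t;ζ) + ζ_0`. -/
def phaseSpherical {r : ℕ} (N : Aut r) (p : CD r) (t : ℝ) (ζ : CD r) : CD r :=
  (re p * t) • one r + sphericalM N p t ζ + re ζ • one r

/-- The image `F_u(p;ζ) = ∫_0^∞ f(t) exp(-u(p,t;ζ)) dt`. For an original with growth exponent `s₀`
the integral converges absolutely if `s₀ < re p`. -/
def image {r : ℕ} (u : CD r → ℝ → CD r → CD r) (f : ℝ → CD r) (p ζ : CD r) : CD r :=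
  ∫ t in Set.Ioi (0 : ℝ), mul (f t) (exp (-(u p t ζ)))

/-- The image written by components, `∑ F_{u,s}(p;ζ) N_s`, where `f = ∑ f_s N_s` with real valued
`f_s` and `F_{u,s}` is the image of `f_s`. -/
def imageByComponents {r : ℕ} (N : Aut r) (u : CD r → ℝ → CD r → CD r) (f : ℝ → CD r)
    (p ζ : CD r) : CD r :=
  ∑ s ∈ Finset.range (2 ^ r), mul (image u (fun t => N.coord (f t) s • one r) p ζ) (N.gen s)

end CayleyDickson

end

noncomputable section

namespace CayleyDickson

/-! Only real parameters `p = s` are needed to recover an original. There all angles with index at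
least 1 are constant in `t`, so either phase equals `s t + w` with `w` depending on `ζ` alone
(`exists_phase_smul_one`). Real numbers lie in every copy of `ℂ` inside the algebra, hence `exp(-(st
+ w)) = e^{-st} exp(-w)`, and the image is the real Laplace transform at `s` times `exp(-w)`, on the
right for `image` and on the left for `imageByComponents`.

The factor `exp(-w)` is nonzero and can be cancelled: quaternions and octonions have no zero
divisors, and for `r ≥ 4` the transforms are real (`AdmissibleValues.laplace_eq`). Equal Laplace
transforms on a half-line give equal functions almost everywhere, by Weierstrass approximation in
the variable `e^{-t}`; continuity upgrades this to equality at common points of continuity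
(`IsOriginal.eq_of_laplace_eq`).

Conversely, discontinuities are countable, so agreement at common points of continuity is agreement
almost everywhere, which the integrals cannot detect. -/

/-! ### Coordinates, halves and conjugation. -/

lemma ofCoord_apply (r : ℕ) (c : ℕ → ℝ) (j : Fin (2 ^ r)) : ofCoord r c j = c j := rfl

lemma coord_ofCoord {r : ℕ} (c : ℕ → ℝ) {j : ℕ} (h : j < 2 ^ r) : coord (ofCoord r c) j = c j := by
  simp [coord, h, ofCoord_apply]

lemma coord_of_le {r : ℕ} (x : CD r) {j : ℕ} (h : 2 ^ r ≤ j) : coord x j = 0 := by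
  simp [coord, not_lt.2 h]

lemma ext_coord {r : ℕ} {x y : CD r} (h : ∀ j < 2 ^ r, coord x j = coord y j) : x = y := by
  ext j
  simpa [coord] using h j j.2

@[simp] lemma coord_add {r : ℕ} (x y : CD r) (j : ℕ) : coord (x + y) j = coord x j + coord y j := by
  unfold coord; split <;> simp

@[simp] lemma coord_sub {r : ℕ} (x y : CD r) (j : ℕ) : coord (x - y) j = coord x j - coord y j := by
  unfold coord; split <;> simp

@[simp] lemma coord_neg {r : ℕ} (x : CD r) (j : ℕ) : coord (-x) j = - coord x j := by
  unfold coord; split <;> simp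

@[simp] lemma coord_smul {r : ℕ} (c : ℝ) (x : CD r) (j : ℕ) :
    coord (c • x) j = c * coord x j := by
  unfold coord; split <;> simp

@[simp] lemma coord_zero {r : ℕ} (j : ℕ) : coord (0 : CD r) j = 0 := by
  unfold coord; split <;> simp

lemma two_pow_succ_eq (r : ℕ) : 2 ^ (r + 1) = 2 ^ r + 2 ^ r := by ring

lemma coord_lo {r : ℕ} (x : CD (r + 1)) {j : ℕ} (h : j < 2 ^ r) : coord (lo x) j = coord x j :=
  coord_ofCoord _ h

lemma coord_hi {r : ℕ} (x : CD (r + 1)) {j : ℕ} (h : j < 2 ^ r) :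
    coord (hi x) j = coord x (2 ^ r + j) :=
  coord_ofCoord _ h

lemma coord_glue {r : ℕ} (a b : CD r) (j : ℕ) :
    coord (glue a b) j = if j < 2 ^ r then coord a j else coord b (j - 2 ^ r) := by
  by_cases h : j < 2 ^ (r + 1)
  · exact coord_ofCoord _ h
  · have h2 := two_pow_succ_eq r
    rw [coord_of_le _ (not_lt.1 h), if_neg (by omega), coord_of_le _ (by omega)]

@[simp] lemma lo_glue {r : ℕ} (a b : CD r) : lo (glue a b) = a :=
  ext_coord fun j h => by rw [coord_lo _ h, coord_glue, if_pos h]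

@[simp] lemma hi_glue {r : ℕ} (a b : CD r) : hi (glue a b) = b :=
  ext_coord fun j h => by rw [coord_hi _ h, coord_glue, if_neg (by omega), Nat.add_sub_cancel_left]

lemma glue_lo_hi {r : ℕ} (x : CD (r + 1)) : glue (lo x) (hi x) = x :=
  ext_coord fun j h => by
    have h2 := two_pow_succ_eq r
    rw [coord_glue]
    split_ifs with hj
    · exact coord_lo _ hj
    · rw [coord_hi _ (by omega)]; congr 1; omega

/-- Case distinction into the two halves of an element of the doubled algebra. -/
lemma exists_glue {r : ℕ} (x : CD (r + 1)) : ∃ a b, x = glue a b := ⟨_, _, (glue_lo_hi x).symm⟩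

lemma glue_add {r : ℕ} (a b c d : CD r) : glue a b + glue c d = glue (a + c) (b + d) :=
  ext_coord fun j _ => by simp only [coord_add, coord_glue]; split_ifs <;> rfl

lemma smul_glue {r : ℕ} (k : ℝ) (a b : CD r) : k • glue a b = glue (k • a) (k • b) :=
  ext_coord fun j _ => by simp only [coord_smul, coord_glue]; split_ifs <;> rfl

lemma mul_glue {r : ℕ} (a b c d : CD r) :
    mul (glue a b) (glue c d) =
      glue (mul a c - mul (conj d) b) (mul d a + mul b (conj c)) := by
  conv_lhs => unfold mul
  simp

lemma mul_level_zero (x y : CD 0) : mul x y = ofCoord 0 fun _ => coord x 0 * coord y 0 := by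
  unfold mul; rfl

lemma coord_conj {r : ℕ} (x : CD r) (j : ℕ) :
    coord (conj x) j = if j = 0 then coord x 0 else - coord x j := by
  by_cases h : j < 2 ^ r
  · exact coord_ofCoord _ h
  · have : j ≠ 0 := by rintro rfl; exact h (by positivity)
    rw [coord_of_le _ (not_lt.1 h), if_neg this, coord_of_le _ (not_lt.1 h), neg_zero]

lemma conj_glue {r : ℕ} (a b : CD r) : conj (glue a b) = glue (conj a) (-b) :=
  ext_coord fun j _ => by
    have : 0 < 2 ^ r := by positivity
    by_cases h0 : j = 0
    · subst h0; simp [coord_conj, coord_glue]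
    · by_cases hj : j < 2 ^ r <;> simp [coord_conj, coord_glue, h0, hj]

@[simp] lemma conj_add {r : ℕ} (x y : CD r) : conj (x + y) = conj x + conj y :=
  ext_coord fun j _ => by
    simp only [coord_conj, coord_add]; split_ifs <;> ring

@[simp] lemma conj_smul {r : ℕ} (k : ℝ) (x : CD r) : conj (k • x) = k • conj x :=
  ext_coord fun j _ => by
    simp only [coord_conj, coord_smul]; split_ifs <;> ring

@[simp] lemma conj_zero {r : ℕ} : conj (0 : CD r) = 0 := by
  simpa using conj_smul 0 (0 : CD r)

@[simp] lemma conj_neg {r : ℕ} (x : CD r) : conj (-x) = -conj x := by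
  simpa using conj_smul (-1) x

@[simp] lemma conj_sub {r : ℕ} (x y : CD r) : conj (x - y) = conj x - conj y := by
  simp [sub_eq_add_neg]

@[simp] lemma conj_conj {r : ℕ} (x : CD r) : conj (conj x) = x :=
  ext_coord fun j _ => by
    simp only [coord_conj]; split_ifs with h
    · rw [h]
    · ring

lemma conj_level_zero (x : CD 0) : conj x = x :=
  ext_coord fun j h => by
    obtain rfl : j = 0 := by simpa using h
    simp [coord_conj]

/-! ### Bilinearity and the unit. -/

/-- Doubling reverses the order of some factors, so each distributive law one level up needs both
laws below; hence the joint induction. -/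
lemma add_mul_and_mul_add (r : ℕ) : (∀ x y z : CD r, mul (x + y) z = mul x z + mul y z) ∧
    ∀ x y z : CD r, mul x (y + z) = mul x y + mul x z := by
  induction r with
  | zero =>
    constructor <;> intro x y z <;> simp only [mul_level_zero] <;> ext j <;>
      simp [ofCoord_apply, add_mul, mul_add]
  | succ r ih =>
    obtain ⟨h1, h2⟩ := ih
    constructor <;> intro x y z <;> obtain ⟨a, b, rfl⟩ := exists_glue x <;>
      obtain ⟨c, d, rfl⟩ := exists_glue y <;> obtain ⟨e, f, rfl⟩ := exists_glue z <;>
      simp only [glue_add, mul_glue, h1, h2, conj_add] <;> congr 1 <;> abel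

lemma smul_mul_and_mul_smul (r : ℕ) : (∀ (k : ℝ) (x y : CD r), mul (k • x) y = k • mul x y) ∧
    ∀ (k : ℝ) (x y : CD r), mul x (k • y) = k • mul x y := by
  induction r with
  | zero =>
    constructor <;> intro k x y <;> simp only [mul_level_zero] <;> ext j <;>
      simp [ofCoord_apply] <;> ring
  | succ r ih =>
    obtain ⟨h1, h2⟩ := ih
    constructor <;> intro k x y <;> obtain ⟨a, b, rfl⟩ := exists_glue x <;>
      obtain ⟨c, d, rfl⟩ := exists_glue y <;>
      simp only [smul_glue, mul_glue, h1, h2, conj_smul, smul_add, smul_sub]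

/-- The Cayley-Dickson product as a bilinear map. -/
def mulₗ (r : ℕ) : CD r →ₗ[ℝ] CD r →ₗ[ℝ] CD r :=
  LinearMap.mk₂ ℝ mul (add_mul_and_mul_add r).1 (smul_mul_and_mul_smul r).1
    (add_mul_and_mul_add r).2 (smul_mul_and_mul_smul r).2

lemma mulₗ_apply {r : ℕ} (x y : CD r) : mulₗ r x y = mul x y := rfl

section bilinear
variable {r : ℕ} (x y z : CD r) (k : ℝ)

lemma add_mul' : mul (x + y) z = mul x z + mul y z := (add_mul_and_mul_add r).1 x y z
lemma mul_add' : mul x (y + z) = mul x y + mul x z := (add_mul_and_mul_add r).2 x y z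
lemma smul_mul' : mul (k • x) y = k • mul x y := (smul_mul_and_mul_smul r).1 k x y
lemma mul_smul' : mul x (k • y) = k • mul x y := (smul_mul_and_mul_smul r).2 k x y
lemma zero_mul' : mul 0 x = 0 := by simpa using smul_mul' 0 x 0
lemma mul_zero' : mul x 0 = 0 := by simpa using mul_smul' x 0 0
lemma neg_mul' : mul (-x) y = -mul x y := by simpa using smul_mul' x y (-1)
lemma mul_neg' : mul x (-y) = -mul x y := by simpa using mul_smul' x y (-1)
lemma sub_mul' : mul (x - y) z = mul x z - mul y z := by
  rw [sub_eq_add_neg, add_mul', neg_mul', ← sub_eq_add_neg]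
lemma mul_sub' : mul x (y - z) = mul x y - mul x z := by
  rw [sub_eq_add_neg, mul_add', mul_neg', ← sub_eq_add_neg]

end bilinear

lemma coord_one {r : ℕ} (j : ℕ) : coord (one r) j = if j = 0 then 1 else 0 := by
  by_cases h : j < 2 ^ r
  · simp only [one, gen, coord_ofCoord _ h]
  · have : j ≠ 0 := by rintro rfl; exact h (by positivity)
    rw [coord_of_le _ (not_lt.1 h), if_neg this]

lemma one_succ (r : ℕ) : one (r + 1) = glue (one r) 0 :=
  ext_coord fun j _ => by
    have : 0 < 2 ^ r := by positivity
    simp only [coord_glue, coord_one, coord_zero]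
    split_ifs <;> first | rfl | omega

@[simp] lemma conj_one (r : ℕ) : conj (one r) = one r :=
  ext_coord fun j _ => by
    simp only [coord_conj, coord_one]; split_ifs <;> simp_all

lemma one_mul_and_mul_one (r : ℕ) (x : CD r) : mul (one r) x = x ∧ mul x (one r) = x := by
  induction r with
  | zero =>
    constructor <;> refine ext_coord fun j h => ?_ <;>
      (obtain rfl : j = 0 := by simpa using h) <;>
      simp [mul_level_zero, coord_ofCoord, coord_one]
  | succ r ih =>
    obtain ⟨a, b, rfl⟩ := exists_glue x
    simp [one_succ, mul_glue, (ih _).1, (ih _).2, mul_zero', zero_mul']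

lemma one_mul' {r : ℕ} (x : CD r) : mul (one r) x = x := (one_mul_and_mul_one r x).1
lemma mul_one' {r : ℕ} (x : CD r) : mul x (one r) = x := (one_mul_and_mul_one r x).2

lemma one_ne_zero' (r : ℕ) : one r ≠ 0 := fun h => by
  simpa [coord_one] using congrArg (coord · 0) h

/-! ### The norm form, associativity and absence of zero divisors. -/

/-- The sum of the squares of the coordinates. -/
def normSq {r : ℕ} (x : CD r) : ℝ := ∑ j ∈ Finset.range (2 ^ r), coord x j ^ 2

lemma normSq_glue {r : ℕ} (a b : CD r) : normSq (glue a b) = normSq a + normSq b := by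
  unfold normSq
  rw [two_pow_succ_eq, Finset.sum_range_add]
  congr 1 <;> refine Finset.sum_congr rfl fun j hj => ?_ <;>
    have := Finset.mem_range.1 hj <;> simp [coord_glue, this]

lemma normSq_smul {r : ℕ} (k : ℝ) (a : CD r) : normSq (k • a) = k ^ 2 * normSq a := by
  simp [normSq, Finset.mul_sum, mul_pow]

lemma normSq_nonneg {r : ℕ} (a : CD r) : 0 ≤ normSq a := Finset.sum_nonneg fun _ _ => sq_nonneg _

lemma normSq_eq_zero {r : ℕ} {a : CD r} : normSq a = 0 ↔ a = 0 := by
  refine ⟨fun h => ext_coord fun j hj => ?_, fun h => by simp [h, normSq]⟩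
  have := (Finset.sum_eq_zero_iff_of_nonneg fun _ _ => sq_nonneg _).1 h j (Finset.mem_range.2 hj)
  simpa using this

/-- The identities are proved jointly because `x x*` for `x = a + b l` has first half `a a* + b* b`.
-/
lemma mul_conj_self_and (r : ℕ) (x : CD r) :
    mul x (conj x) = normSq x • one r ∧ mul (conj x) x = normSq x • one r := by
  induction r with
  | zero =>
    constructor <;> refine ext_coord fun j h => ?_ <;>
      (obtain rfl : j = 0 := by simpa using h) <;>
      simp [mul_level_zero, coord_ofCoord, coord_one, conj_level_zero, normSq, sq]
  | succ r ih =>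
    obtain ⟨a, b, rfl⟩ := exists_glue x
    constructor
    · simp [conj_glue, mul_glue, neg_mul', (ih _).1, (ih _).2, normSq_glue, one_succ, smul_glue,
        add_smul, glue_add]
    · simp [conj_glue, mul_glue, neg_mul', mul_neg', (ih _).2, normSq_glue, one_succ,
        smul_glue, add_smul, glue_add]

lemma mul_conj_self {r : ℕ} (x : CD r) : mul x (conj x) = normSq x • one r :=
  (mul_conj_self_and r x).1

lemma conj_mul_self {r : ℕ} (x : CD r) : mul (conj x) x = normSq x • one r :=
  (mul_conj_self_and r x).2

lemma mul_comm_zero (x y : CD 0) : mul x y = mul y x := by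
  simp [mul_level_zero, mul_comm]

lemma mul_assoc_zero (x y z : CD 0) : mul (mul x y) z = mul x (mul y z) := by
  simp [mul_level_zero, mul_assoc, coord_ofCoord]

lemma conj_mul' {r : ℕ} (x y : CD r) : conj (mul x y) = mul (conj y) (conj x) := by
  induction r with
  | zero => simp only [conj_level_zero, mul_comm_zero x y]
  | succ r ih =>
    obtain ⟨a, b, rfl⟩ := exists_glue x
    obtain ⟨c, d, rfl⟩ := exists_glue y
    simp only [mul_glue, conj_glue, conj_sub, ih, conj_conj, conj_neg, neg_mul', mul_neg', neg_neg]
    congr 1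
    abel

lemma mul_comm_one (x y : CD 1) : mul x y = mul y x := by
  obtain ⟨a, b, rfl⟩ := exists_glue x
  obtain ⟨c, d, rfl⟩ := exists_glue y
  simp only [mul_glue, conj_level_zero, mul_comm_zero c, mul_comm_zero d]
  rw [add_comm]

/-- Doubling a commutative and associative algebra yields an associative one. -/
lemma mul_assoc_succ {r : ℕ} (hc : ∀ x y : CD r, mul x y = mul y x)
    (ha : ∀ x y z : CD r, mul (mul x y) z = mul x (mul y z)) (x y z : CD (r + 1)) :
    mul (mul x y) z = mul x (mul y z) := by
  -- Left commutativity lets `simp` sort the factors of each monomial, after which `abel` can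
  -- compare the sums.
  have hlc : ∀ x y z : CD r, mul x (mul y z) = mul y (mul x z) := fun x y z => by
    rw [← ha, hc x y, ha]
  obtain ⟨a, b, rfl⟩ := exists_glue x
  obtain ⟨c, d, rfl⟩ := exists_glue y
  obtain ⟨e, f, rfl⟩ := exists_glue z
  simp only [mul_glue, conj_sub, conj_add, conj_mul', conj_conj, mul_add', mul_sub', add_mul',
    sub_mul', ha]
  congr 1 <;> simp only [hc, hlc] <;> abel

lemma mul_assoc_two (x y z : CD 2) : mul (mul x y) z = mul x (mul y z) :=
  mul_assoc_succ mul_comm_one (mul_assoc_succ mul_comm_zero mul_assoc_zero) x y z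

/-- This substitutes for associativity in the octonions: after expansion, associativity below turns
each adjacent pair `c`, `c*` or `d`, `d*` into a scalar, and the mixed terms cancel. -/
lemma right_alternative_succ {r : ℕ}
    (ha : ∀ x y z : CD r, mul (mul x y) z = mul x (mul y z)) (x w : CD (r + 1)) :
    mul (mul x w) (conj w) = normSq w • x ∧ mul (conj w) (mul w x) = normSq w • x := by
  obtain ⟨a, b, rfl⟩ := exists_glue x
  obtain ⟨c, d, rfl⟩ := exists_glue w
  have h1 : ∀ x y : CD r, mul x (mul (conj x) y) = normSq x • y := fun x y => by
    rw [← ha, mul_conj_self, smul_mul', one_mul']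
  have h2 : ∀ x y : CD r, mul (conj x) (mul x y) = normSq x • y := fun x y => by
    rw [← ha, conj_mul_self, smul_mul', one_mul']
  simp only [mul_glue, conj_glue, conj_sub, conj_add, conj_mul', conj_conj, mul_add', mul_sub',
    add_mul', sub_mul', neg_mul', mul_neg', conj_neg, ha, smul_glue, normSq_glue, add_smul, h1, h2,
    conj_mul_self, mul_conj_self, mul_smul', mul_one', glue_add]
  constructor <;> congr 1 <;> abel

/-- The quaternions and the octonions have no zero divisors. -/
lemma eq_zero_or_eq_zero_of_mul_eq_zero {r : ℕ} (hr : r = 2 ∨ r = 3) {x y : CD r}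
    (h : mul x y = 0) : x = 0 ∨ y = 0 := by
  have key : mul (mul x y) (conj y) = normSq y • x := by
    rcases hr with rfl | rfl
    · rw [mul_assoc_two, mul_conj_self, mul_smul', mul_one']
    · exact (right_alternative_succ mul_assoc_two x y).1
  rw [h, zero_mul', eq_comm, smul_eq_zero, normSq_eq_zero] at key
  exact key.symm


/-! ### The exponential, computed in copies of the complex numbers. -/

/-- The real linear map `ℂ → 𝒜_r` that sends `1` to `1` and `i` to `J`. -/
def ofComplex {r : ℕ} (J : CD r) : ℂ →L[ℝ] CD r :=
  Complex.reCLM.smulRight (one r) + Complex.imCLM.smulRight J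

lemma ofComplex_apply {r : ℕ} (J : CD r) (z : ℂ) : ofComplex J z = z.re • one r + z.im • J := rfl

lemma ofComplex_one {r : ℕ} (J : CD r) : ofComplex J 1 = one r := by simp [ofComplex_apply]

lemma ofComplex_mul {r : ℕ} {J : CD r} (hJ : mul J J = -one r) (z w : ℂ) :
    ofComplex J (z * w) = mul (ofComplex J z) (ofComplex J w) := by
  simp only [ofComplex_apply, add_mul', mul_add', smul_mul', mul_smul', one_mul', mul_one', hJ,
    Complex.mul_re, Complex.mul_im]
  module

lemma npow_ofComplex {r : ℕ} {J : CD r} (hJ : mul J J = -one r) (z : ℂ) (n : ℕ) :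
    npow (ofComplex J z) n = ofComplex J (z ^ n) := by
  induction n with
  | zero => simp [npow, ofComplex_one]
  | succ n ih => rw [npow, ih, pow_succ', ofComplex_mul hJ]

lemma exp_ofComplex {r : ℕ} {J : CD r} (hJ : mul J J = -one r) (z : ℂ) :
    exp (ofComplex J z) = ofComplex J (Complex.exp z) := by
  have h := (NormedSpace.exp_series_hasSum_exp' (𝕂 := ℝ) z).mapL (ofComplex J)
  rw [Complex.exp_eq_exp_ℂ, ← h.tsum_eq]
  simp only [exp, npow_ofComplex hJ, map_smul]

/-- Every element lies in a copy of the complex numbers. -/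
lemma exists_eq_ofComplex {r : ℕ} (hr : 1 ≤ r) (w : CD r) :
    ∃ J : CD r, mul J J = -one r ∧ ∃ z : ℂ, w = ofComplex J z := by
  have himag : ∀ v : CD r, coord v 0 = 0 → mul v v = -(normSq v • one r) := fun v hv => by
    have hc : conj v = -v := ext_coord fun j _ => by
      rw [coord_conj, coord_neg]
      split_ifs with h
      · rw [h, hv, neg_zero]
      · rfl
    rw [← mul_conj_self, hc, mul_neg', neg_neg]
  set v := w - re w • one r with hv
  have hv0 : coord v 0 = 0 := by simp [hv, re, coord_one]
  by_cases h : v = 0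
  -- For real `w` any imaginary unit serves; `i_1` exists since `r ≥ 1`. Otherwise `J` is the
  -- normalised imaginary part.
  · have h1 : 1 < 2 ^ r := Nat.one_lt_two_pow (by omega)
    have hJ : normSq (gen r 1) = 1 := by
      rw [normSq, Finset.sum_eq_single_of_mem 1 (Finset.mem_range.2 h1)]
      · simp [gen, coord_ofCoord _ h1]
      · intro j hj h1
        simp [gen, coord_ofCoord _ (Finset.mem_range.1 hj), h1]
    refine ⟨gen r 1, ?_, re w, ?_⟩
    · rw [himag, hJ, one_smul]
      simp [gen, coord_ofCoord _ (show 0 < 2 ^ r by positivity)]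
    · rw [sub_eq_zero.1 (hv.symm.trans h)]
      simp [ofComplex_apply, re, coord_one]
  · have hpos : 0 < normSq v :=
      lt_of_le_of_ne (normSq_nonneg v) fun h0 => h (normSq_eq_zero.1 h0.symm)
    have hs : 0 < √(normSq v) := Real.sqrt_pos.2 hpos
    refine ⟨(√(normSq v))⁻¹ • v, ?_, ⟨re w, √(normSq v)⟩, ?_⟩
    · rw [himag _ (by simp [hv0]), normSq_smul, inv_pow, Real.sq_sqrt hpos.le,
        inv_mul_cancel₀ hpos.ne', one_smul]
    · simp only [ofComplex_apply, smul_smul, mul_inv_cancel₀ hs.ne', one_smul]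
      simp [hv]

/-- Inside its copy of `ℂ` the exponential is invertible; this holds even when the algebra has zero
divisors. -/
lemma exp_ne_zero {r : ℕ} (hr : 1 ≤ r) (w : CD r) : exp w ≠ 0 := by
  obtain ⟨J, hJ, z, rfl⟩ := exists_eq_ofComplex hr w
  rw [exp_ofComplex hJ]
  intro h
  apply one_ne_zero' r
  rw [← ofComplex_one J, ← Complex.exp_ne_zero z |> mul_inv_cancel₀, ofComplex_mul hJ, h,
    zero_mul']

lemma exp_smul_one_add {r : ℕ} (hr : 1 ≤ r) (x : ℝ) (w : CD r) :
    exp (x • one r + w) = Real.exp x • exp w := by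
  obtain ⟨J, hJ, z, rfl⟩ := exists_eq_ofComplex hr w
  have h : x • one r + ofComplex J z = ofComplex J (x + z) := by
    rw [map_add]; simp [ofComplex_apply]
  rw [h, exp_ofComplex hJ, exp_ofComplex hJ, Complex.exp_add, ← map_smul, ← Complex.ofReal_exp,
    Complex.real_smul]

/-! ### Automorphisms and the phases at real parameters. -/

lemma Aut.toEquiv_one {r : ℕ} (N : Aut r) : N.toEquiv (one r) = one r := by
  have h := N.map_mul (N.toEquiv.symm (one r)) (one r)
  rw [mul_one', LinearEquiv.apply_symm_apply, one_mul'] at h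
  exact h.symm

lemma Aut.symm_one {r : ℕ} (N : Aut r) : N.toEquiv.symm (one r) = one r := by
  rw [LinearEquiv.symm_apply_eq, N.toEquiv_one]

/-- A coordinate as a continuous linear functional. -/
def coordL (r j : ℕ) : CD r →L[ℝ] ℝ :=
  LinearMap.toContinuousLinearMap
    { toFun := fun x => coord x j
      map_add' := fun x y => coord_add x y j
      map_smul' := fun k x => coord_smul k x j }

lemma coordL_apply {r : ℕ} (x : CD r) (j : ℕ) : coordL r j x = coord x j := rfl

/-- A coordinate in the basis `N` as a continuous linear functional. -/
def Aut.coordL {r : ℕ} (N : Aut r) (j : ℕ) : CD r →L[ℝ] ℝ :=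
  (CayleyDickson.coordL r j).comp (LinearMap.toContinuousLinearMap N.toEquiv.symm.toLinearMap)

lemma Aut.coordL_apply {r : ℕ} (N : Aut r) (x : CD r) (j : ℕ) : N.coordL j x = N.coord x j := rfl

lemma sum_coord_smul_gen {r : ℕ} (x : CD r) :
    ∑ j ∈ Finset.range (2 ^ r), coord x j • gen r j = x := by
  refine ext_coord fun k hk => ?_
  rw [← coordL_apply, map_sum, Finset.sum_eq_single_of_mem k (Finset.mem_range.2 hk)]
  · simp [coordL_apply, gen, coord_ofCoord _ hk]
  · intro j _ hj
    simp [coordL_apply, gen, coord_ofCoord _ hk, hj.symm]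

lemma Aut.sum_coord_smul_gen {r : ℕ} (N : Aut r) (x : CD r) :
    ∑ j ∈ Finset.range (2 ^ r), N.coord x j • N.gen j = x := by
  simp only [Aut.gen, Aut.coord, ← map_smul, ← map_sum, CayleyDickson.sum_coord_smul_gen,
    LinearEquiv.apply_symm_apply]

lemma Aut.coord_smul_one {r : ℕ} (N : Aut r) (k : ℝ) {j : ℕ} (hj : j ≠ 0) :
    N.coord (k • one r) j = 0 := by
  simp [Aut.coord, N.symm_one, coord_one, hj]

/-- Automorphisms fix 1, so a real `p` has zero coordinates at every index at least 1, and only such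
indices enter `M_N`. -/
lemma sphericalM_smul_one {r : ℕ} (N : Aut r) (s t : ℝ) (ζ : CD r) :
    sphericalM N (s • one r) t ζ = sphericalM N 0 0 ζ := by
  have h : ∀ j ≠ 0, angle N (s • one r) t ζ j = angle N 0 0 ζ j := fun j hj => by
    simp [angle, N.coord_smul_one s hj]
  unfold sphericalM
  rw [h 1 one_ne_zero]
  congr 1
  refine Finset.sum_congr rfl fun k _ => ?_
  rw [h (k + 1) k.succ_ne_zero]
  congr 2
  exact Finset.prod_congr rfl fun j hj => by
    rw [h j (by have := (Finset.mem_Icc.1 hj).1; omega)]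

/-- On the real axis both phases are affine functions with a constant depending only on `ζ`. -/
lemma exists_phase_smul_one {r : ℕ} (N : Aut r) {u : CD r → ℝ → CD r → CD r}
    (hu : u = phaseLinear ∨ u = phaseSpherical N) (ζ : CD r) :
    ∃ w : CD r, ∀ s t : ℝ, u (s • one r) t ζ = (s * t) • one r + w := by
  rcases hu with rfl | rfl
  · exact ⟨ζ, fun s t => by rw [phaseLinear, smul_smul, mul_comm]⟩
  · refine ⟨sphericalM N 0 0 ζ + re ζ • one r, fun s t => ?_⟩
    simp [phaseSpherical, sphericalM_smul_one, re, coord_one, add_assoc]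

/-! ### Uniqueness for the Laplace transform. -/

/-- A function whose moments against all `exp (-n t)` vanish is zero almost everywhere. -/
lemma ae_eq_zero_of_integral_exp_neg_nat_mul_eq_zero {E : Type*} [NormedAddCommGroup E]
    [NormedSpace ℝ E] [CompleteSpace E] {h : ℝ → E} (hi : IntegrableOn h (Set.Ioi 0))
    (hm : ∀ n : ℕ, ∫ t in Set.Ioi (0 : ℝ), Real.exp (-t) ^ n • h t = 0) :
    ∀ᵐ t ∂volume.restrict (Set.Ioi (0 : ℝ)), h t = 0 := by
  have hbdd : ∀ q : ℝ → ℝ, ContinuousOn q (Set.Icc 0 1) →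
      IntegrableOn (fun t => q (Real.exp (-t)) • h t) (Set.Ioi 0) := fun q hq => by
    obtain ⟨C, hC⟩ := isCompact_Icc.exists_bound_of_continuousOn hq
    have hmaps : Set.MapsTo (fun t : ℝ => Real.exp (-t)) (Set.Ioi 0) (Set.Icc 0 1) :=
      fun t ht => ⟨(Real.exp_pos _).le, Real.exp_le_one_iff.2 (by simpa using (le_of_lt ht))⟩
    refine Integrable.bdd_smul (C := C) hi ?_ ?_
    · exact (hq.comp (by fun_prop) hmaps).aestronglyMeasurable measurableSet_Ioi
    · exact (ae_restrict_mem measurableSet_Ioi).mono fun t ht => hC _ (hmaps ht)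
  have hpoly : ∀ P : Polynomial ℝ,
      ∫ t in Set.Ioi (0 : ℝ), P.eval (Real.exp (-t)) • h t = 0 := fun P => by
    simp only [Polynomial.eval_eq_sum_range, Finset.sum_smul, mul_smul]
    rw [integral_finsetSum]
    · simp [integral_smul, hm]
    · exact fun n _ => (hbdd (fun x => x ^ n) (by fun_prop)).smul (P.coeff n)
  have hcont : ∀ q : ℝ → ℝ, ContinuousOn q (Set.Icc 0 1) →
      ∫ t in Set.Ioi (0 : ℝ), q (Real.exp (-t)) • h t = 0 := fun q hq => by
    set K := ∫ t in Set.Ioi (0 : ℝ), ‖h t‖ with hK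
    have hK0 : 0 ≤ K := integral_nonneg fun _ => norm_nonneg _
    refine norm_le_zero_iff.1 (le_of_forall_pos_le_add fun ε hε => ?_)
    -- The `+ 1` keeps the tolerance meaningful when `K = 0`.
    obtain ⟨P, hP⟩ := exists_polynomial_near_of_continuousOn 0 1 q hq (ε / (K + 1)) (by positivity)
    have hPi := hbdd (fun x => P.eval x) (by fun_prop)
    calc ‖∫ t in Set.Ioi (0 : ℝ), q (Real.exp (-t)) • h t‖
        = ‖∫ t in Set.Ioi (0 : ℝ),
            (q (Real.exp (-t)) • h t - P.eval (Real.exp (-t)) • h t)‖ := by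
          rw [integral_sub (hbdd q hq) hPi, hpoly, sub_zero]
      _ ≤ ∫ t in Set.Ioi (0 : ℝ), ε / (K + 1) * ‖h t‖ := by
          refine norm_integral_le_of_norm_le (hi.norm.const_mul _) ?_
          refine (ae_restrict_mem measurableSet_Ioi).mono fun t ht => ?_
          rw [← sub_smul, norm_smul, norm_sub_rev]
          exact mul_le_mul_of_nonneg_right (hP _ ⟨(Real.exp_pos _).le,
            Real.exp_le_one_iff.2 (by simpa using (le_of_lt ht))⟩).le (norm_nonneg _)
      _ = ε / (K + 1) * K := integral_const_mul _ _
      _ ≤ 0 + ε := by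
          rw [zero_add, div_mul_eq_mul_div, div_le_iff₀ (by positivity)]
          nlinarith
  rw [ae_restrict_iff' measurableSet_Ioi]
  refine isOpen_Ioi.ae_eq_zero_of_integral_contDiff_smul_eq_zero hi.locallyIntegrableOn ?_
  intro φ hφ hφc hφs
  -- The substitution `x = e^{-t}` turns a test function `φ` supported in `(0, ∞)` into a continuous
  -- function on `[0, 1]`.
  have hq := hcont (fun x => φ (-Real.log x)) ?_
  · rw [← hq, ← setIntegral_eq_integral_of_forall_compl_eq_zero (s := Set.Ioi 0)]
    · simp
    · intro t ht
      rw [image_eq_zero_of_notMem_tsupport fun h => ht (hφs h), zero_smul]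
  · intro x hx
    refine ContinuousAt.continuousWithinAt ?_
    by_cases h0 : x = 0
    · subst h0
      -- Since `Real.log 0 = 0`, the value at `x = 0` is `φ 0 = 0`; it matches the limit, because
      -- `-log x → ∞` as `x → 0` and `φ` has compact support.
      have hz : φ (-Real.log 0) = 0 := by
        simpa using image_eq_zero_of_notMem_tsupport fun h => lt_irrefl (0 : ℝ) (hφs h)
      rw [continuousAt_iff_punctured_nhds, hz]
      exact (hφc.is_zero_at_infty.mono_left atTop_le_cocompact).comp
        (tendsto_neg_atBot_atTop.comp Real.tendsto_log_nhdsNE_zero)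
    · exact hφ.continuous.continuousAt.comp (Real.continuousAt_log h0).neg

/-- A nonzero value would persist on an interval `(t, b)` of positive measure. The right-hand side
is used so that `t = 0` is covered. -/
lemma eq_zero_of_ae_eq_zero {E : Type*} [NormedAddCommGroup E] {h : ℝ → E}
    (hz : ∀ᵐ t ∂volume.restrict (Set.Ioi (0 : ℝ)), h t = 0) {t : ℝ} (ht : 0 ≤ t)
    (hc : ContinuousAt h t) : h t = 0 := by
  by_contra hne
  obtain ⟨b, hb, hsub⟩ := mem_nhdsGT_iff_exists_Ioo_subset.1
    (mem_nhdsWithin_of_mem_nhds (hc.eventually_ne hne))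
  have hz' := (ae_restrict_iff' measurableSet_Ioi).1 hz
  have : volume (Set.Ioo t b) = 0 :=
    measure_mono_null (fun x hx (h0 : x ∈ Set.Ioi 0 → h x = 0) =>
      hsub hx (h0 (lt_of_le_of_lt ht hx.1))) hz'
  rw [Real.volume_Ioo, ENNReal.ofReal_eq_zero] at this
  exact absurd hb (by simpa using this)

/-! ### Measurability and integrability of originals. -/

namespace IsOriginal

variable {r : ℕ} {f g : ℝ → CD r} {sf sg : ℝ}

lemma countable_disc (hf : IsOriginal f sf) : {t : ℝ | ¬ ContinuousAt f t}.Countable := by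
  have : {t : ℝ | ¬ ContinuousAt f t} ⊆
      ⋃ n : ℕ, {t : ℝ | t ∈ Set.Icc (-(n : ℝ)) n ∧ ¬ ContinuousAt f t} := fun t ht => by
    obtain ⟨n, hn⟩ := exists_nat_ge |t|
    exact Set.mem_iUnion.2 ⟨n, abs_le.1 hn, ht⟩
  exact (Set.countable_iUnion fun n => (hf.finite_disc _ _).countable).mono this

lemma ae_continuousAt (hf : IsOriginal f sf) : ∀ᵐ t : ℝ, ContinuousAt f t :=
  hf.countable_disc.measure_zero volume

lemma aestronglyMeasurable (hf : IsOriginal f sf) : AEStronglyMeasurable f volume := by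
  have hm := hf.countable_disc.measurableSet.compl
  have hc : ContinuousOn f {t : ℝ | ¬ ContinuousAt f t}ᶜ := fun t ht =>
    (not_not.1 ht).continuousWithinAt
  have := hc.aestronglyMeasurable (μ := volume) hm
  rwa [Measure.restrict_eq_self_of_ae_mem] at this
  exact hf.ae_continuousAt.mono fun t ht => not_not.2 ht

lemma integrableOn (hf : IsOriginal f sf) {s : ℝ} (hs : sf < s) :
    IntegrableOn (fun t => Real.exp (-(s * t)) • f t) (Set.Ioi 0) := by
  obtain ⟨C, hC, hb⟩ := hf.growth
  refine Integrable.mono' (((integrableOn_exp_mul_Ioi (a := sf - s) (by linarith) 0)).const_mul C)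
    ?_ ?_
  · exact (by fun_prop : Continuous fun t => Real.exp (-(s * t))).aestronglyMeasurable.smul
      hf.aestronglyMeasurable.restrict
  · refine ae_of_all _ fun t => ?_
    rw [norm_smul, Real.norm_of_nonneg (Real.exp_pos _).le]
    calc Real.exp (-(s * t)) * ‖f t‖ ≤ Real.exp (-(s * t)) * (C * Real.exp (sf * t)) := by
          gcongr; exact (hb t).le
      _ = C * Real.exp ((sf - s) * t) := by
          rw [mul_left_comm, ← Real.exp_add]; congr 2; ring

end IsOriginal

/-! ### Images at real parameters and cancellation. -/

/-- The real Laplace transform of a function with values in `𝒜_r`. -/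
def laplace {r : ℕ} (f : ℝ → CD r) (s : ℝ) : CD r :=
  ∫ t in Set.Ioi (0 : ℝ), Real.exp (-(s * t)) • f t

section transform

variable {r : ℕ} {f g : ℝ → CD r} {sf sg : ℝ}

lemma map_laplace {E : Type*} [NormedAddCommGroup E] [NormedSpace ℝ E] [CompleteSpace E]
    (T : CD r →L[ℝ] E) {s : ℝ}
    (hf : IntegrableOn (fun t => Real.exp (-(s * t)) • f t) (Set.Ioi 0)) :
    ∫ t in Set.Ioi (0 : ℝ), Real.exp (-(s * t)) • T (f t) = T (laplace f s) := by
  rw [laplace, ← T.integral_comp_comm hf]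
  simp only [map_smul]

lemma image_smul_one (hr : 1 ≤ r) {u : CD r → ℝ → CD r → CD r} {ζ w : CD r}
    (hw : ∀ s t : ℝ, u (s • one r) t ζ = (s * t) • one r + w) {s : ℝ}
    (hf : IntegrableOn (fun t => Real.exp (-(s * t)) • f t) (Set.Ioi 0)) :
    image u f (s • one r) ζ = mul (laplace f s) (exp (-w)) := by
  have h := map_laplace (LinearMap.toContinuousLinearMap ((mulₗ r).flip (exp (-w)))) hf
  simp only [LinearMap.coe_toContinuousLinearMap', LinearMap.flip_apply, mulₗ_apply] at h
  rw [← h, image]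
  congr 1
  funext t
  rw [hw, neg_add, ← neg_smul, exp_smul_one_add hr, mul_smul']

/-- Each component image is a real multiple of `exp(-w)`, and `N_s` multiplies it from the right;
summing over `s` therefore leaves `exp(-w)` on the left. -/
lemma imageByComponents_smul_one (hr : 1 ≤ r) (N : Aut r) {u : CD r → ℝ → CD r → CD r} {ζ w : CD r}
    (hw : ∀ s t : ℝ, u (s • one r) t ζ = (s * t) • one r + w) {s : ℝ}
    (hf : IntegrableOn (fun t => Real.exp (-(s * t)) • f t) (Set.Ioi 0)) :
    imageByComponents N u f (s • one r) ζ = mul (exp (-w)) (laplace f s) := by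
  have h : ∀ j, image u (fun t => N.coord (f t) j • one r) (s • one r) ζ =
      N.coord (laplace f s) j • exp (-w) := fun j => by
    set T : CD r →L[ℝ] CD r := (N.coordL j).smulRight (one r) with hT
    have hTi : IntegrableOn (fun t => Real.exp (-(s * t)) • T (f t)) (Set.Ioi 0) := by
      simpa only [map_smul, IntegrableOn] using T.integrable_comp hf
    have h1 := image_smul_one hr hw (f := fun t => T (f t)) hTi
    rw [laplace, map_laplace T hf] at h1
    simpa only [hT, ContinuousLinearMap.smulRight_apply, Aut.coordL_apply, smul_mul', one_mul']
      using h1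
  simp only [imageByComponents, h, smul_mul', ← mul_smul']
  conv_rhs => rw [← N.sum_coord_smul_gen (laplace f s), ← mulₗ_apply, map_sum]
  rfl

lemma laplace_eq_smul_one {s : ℝ}
    (hf : IntegrableOn (fun t => Real.exp (-(s * t)) • f t) (Set.Ioi 0))
    (hv : ∀ t, ∃ x : ℝ, f t = x • one r) : ∃ x : ℝ, laplace f s = x • one r := by
  refine ⟨coord (laplace f s) 0, ?_⟩
  have h := map_laplace ((coordL r 0).smulRight (one r)) hf
  simp only [ContinuousLinearMap.smulRight_apply, coordL_apply] at h
  rw [← h, laplace]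
  congr 1
  funext t
  obtain ⟨x, hx⟩ := hv t
  simp [hx, coord_one]

lemma AdmissibleValues.two_le (h : AdmissibleValues f) : 2 ≤ r := by
  rcases h with h | h | h <;> omega

/-- For `r ≥ 4` zero divisors do no harm: the difference of the transforms is a real scalar, and a
scalar multiple of `e ≠ 0` vanishes only for the scalar 0. -/
lemma AdmissibleValues.laplace_eq (hf : IsOriginal f sf) (hg : IsOriginal g sg)
    (hfv : AdmissibleValues f) (hgv : AdmissibleValues g) {s : ℝ} (hs : max sf sg < s) {e : CD r}
    (he : e ≠ 0) (h : mul (laplace f s) e = mul (laplace g s) e ∨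
      mul e (laplace f s) = mul e (laplace g s)) : laplace f s = laplace g s := by
  rw [← sub_eq_zero (b := mul _ _), ← sub_eq_zero (b := mul e _), ← sub_mul', ← mul_sub'] at h
  rw [← sub_eq_zero]
  by_cases hr : r = 2 ∨ r = 3
  · rcases h with h | h
    · exact (eq_zero_or_eq_zero_of_mul_eq_zero hr h).resolve_right he
    · exact (eq_zero_or_eq_zero_of_mul_eq_zero hr h).resolve_left he
  · obtain ⟨x, hx⟩ := laplace_eq_smul_one (hf.integrableOn ((le_max_left _ _).trans_lt hs))
      (((or_assoc.2 hfv).resolve_left hr).2)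
    obtain ⟨y, hy⟩ := laplace_eq_smul_one (hg.integrableOn ((le_max_right _ _).trans_lt hs))
      (((or_assoc.2 hgv).resolve_left hr).2)
    rw [hx, hy, ← sub_smul, smul_mul', mul_smul', one_mul', mul_one', or_self, smul_eq_zero] at h
    rw [hx, hy, ← sub_smul, h.resolve_right he, zero_smul]

/-- An original is determined by the values of its real Laplace transform. -/
lemma IsOriginal.eq_of_laplace_eq (hf : IsOriginal f sf) (hg : IsOriginal g sg)
    (h : ∀ s, max sf sg < s → laplace f s = laplace g s) {t : ℝ} (hft : ContinuousAt f t)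
    (hgt : ContinuousAt g t) : f t = g t := by
  rcases lt_or_ge t 0 with ht | ht
  · rw [hf.zero_of_neg t ht, hg.zero_of_neg t ht]
  have hfi := fun s (hs : max sf sg < s) => hf.integrableOn ((le_max_left _ _).trans_lt hs)
  have hgi := fun s (hs : max sf sg < s) => hg.integrableOn ((le_max_right _ _).trans_lt hs)
  set s := max sf sg + 1 with hs
  have hs0 : max sf sg < s := lt_add_one _
  -- The weight `e^{-st}` makes the difference integrable, and its `n`-th moment is the difference
  -- of the Laplace transforms at `s + n`.
  have hz := ae_eq_zero_of_integral_exp_neg_nat_mul_eq_zero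
    (h := fun t => Real.exp (-(s * t)) • f t - Real.exp (-(s * t)) • g t)
    ((hfi s hs0).sub (hgi s hs0)) fun n => by
      have hsn : max sf sg < s + n := hs0.trans_le (by simp)
      have h1 := sub_eq_zero.2 (h _ hsn)
      rw [laplace, laplace, ← integral_sub (hfi _ hsn) (hgi _ hsn)] at h1
      rw [← h1]
      congr 1
      funext t
      rw [smul_sub, smul_smul, smul_smul, ← Real.exp_nat_mul, ← Real.exp_add]
      congr 3 <;> ring_nf
  have := eq_zero_of_ae_eq_zero hz ht (by fun_prop)
  rw [← smul_sub, smul_eq_zero, sub_eq_zero] at this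
  exact this.resolve_left (Real.exp_ne_zero _)

lemma image_congr_ae {u : CD r → ℝ → CD r → CD r} (h : f =ᵐ[volume] g) (p ζ : CD r) :
    image u f p ζ = image u g p ζ :=
  integral_congr_ae (ae_restrict_of_ae (h.mono fun t ht => by simp only [ht]))

end transform

end CayleyDickson

end
open CayleyDickson in
theorem theorem2p21 (r : ℕ) (N : Aut r) (u : CD r → ℝ → CD r → CD r)
    (hu : u = phaseLinear ∨ u = phaseSpherical N)
    (f g : ℝ → CD r) (sf sg : ℝ)
    (hf : IsOriginal f sf) (hg : IsOriginal g sg)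
    (hfv : AdmissibleValues f) (hgv : AdmissibleValues g) (ζ : CD r) :
    ((∀ p : CD r, max sf sg < re p → image u f p ζ = image u g p ζ) ↔
      ∀ t : ℝ, ContinuousAt f t → ContinuousAt g t → f t = g t) ∧
    ((∀ p : CD r, max sf sg < re p →
        imageByComponents N u f p ζ = imageByComponents N u g p ζ) ↔
      ∀ t : ℝ, ContinuousAt f t → ContinuousAt g t → f t = g t) := by
  have hr : 1 ≤ r := one_le_two.trans hfv.two_le
  obtain ⟨w, hw⟩ := exists_phase_smul_one N hu ζ
  have hre : ∀ s : ℝ, re (s • one r) = s := fun s => by simp [re, coord_one]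
  have hfi := fun s (hs : max sf sg < s) => hf.integrableOn ((le_max_left _ _).trans_lt hs)
  have hgi := fun s (hs : max sf sg < s) => hg.integrableOn ((le_max_right _ _).trans_lt hs)
  have hae : (∀ t : ℝ, ContinuousAt f t → ContinuousAt g t → f t = g t) → f =ᵐ[volume] g := by
    intro h
    filter_upwards [hf.ae_continuousAt, hg.ae_continuousAt] with t h1 h2 using h t h1 h2
  refine ⟨⟨fun h t => hf.eq_of_laplace_eq hg fun s hs => ?_, fun h p _ =>
    image_congr_ae (hae h) p ζ⟩, ⟨fun h t => hf.eq_of_laplace_eq hg fun s hs => ?_, fun h p _ => ?_⟩⟩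
  · have h1 := h (s • one r) (by rwa [hre])
    rw [image_smul_one hr hw (hfi s hs), image_smul_one hr hw (hgi s hs)] at h1
    exact AdmissibleValues.laplace_eq hf hg hfv hgv hs (exp_ne_zero hr _) (Or.inl h1)
  · have h1 := h (s • one r) (by rwa [hre])
    rw [imageByComponents_smul_one hr N hw (hfi s hs),
      imageByComponents_smul_one hr N hw (hgi s hs)] at h1
    exact AdmissibleValues.laplace_eq hf hg hfv hgv hs (exp_ne_zero hr _) (Or.inr h1)
  · refine Finset.sum_congr rfl fun j _ => ?_
    have hj : (fun t => N.coord (f t) j • one r) =ᵐ[volume] fun t => N.coord (g t) j • one r :=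
      (hae h).mono fun t ht => by simp only [ht]
    rw [image_congr_ae hj]
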